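/- Let $D$ be a division ring with center $Z(D)$, and let $D^*=D\setminus\{0\}$ be its multiplicative group. A subgroup $G$ of $D^*$ is subnormal if there is a finite chain of subgroups $G=G_n\triangleleft G_{n-1}\triangleleft\cdots\triangleleft G_1\triangleleft G_0=D^*$, and a group is locally nilpotent if each of its finitely generated subgroups is nilpotent. Then every locally nilpotent subnormal subgroup of $D^*$ is central, i.e. it is contained in $Z(D)$. -/

import Mathlib

/-- A group is locally nilpotent if each of its finitely generated subgroups is nilpotent. -/
def IsLocallyNilpotentGroup (G : Type*) [Group G] : Prop :=
  ∀ H : Subgroup G, H.FG → Group.IsNilpotent H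

open scoped commutatorElement

/-! An element `y` of `G` is Engel in all of `Dˣ`: repeated commutators with `y` descend the
subnormal chain into `G`, and there local nilpotence takes them to 1. If `G` were not abelian, a
two-generated nilpotent subgroup would contain `x`, `y` with `z = ⁅y, x⁆ ≠ 1` commuting with both.
On the field generated by `x` and `z`, conjugation by `y` is an endomorphism `s` with `s x = z * x`,
`s z = z`, and `⁅v, y⁆` is `v / s v`. Applied to the elements `1 + c * x`, the Engel condition makes
`z` and every `(1 + c * x) / s (1 + c * x)` a root of unity. A number field has only finitely many,
so the characteristic is a prime, and `x`, likewise `y`, has finite order. Then `x` and `y` lie in a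
finite subring, which is commutative by Wedderburn: a contradiction
(`commute_of_iterate_commutator_eq_one`). For abelian `G`, the same lemma shows that conjugates of
`G` by the next group up the chain commute with each other, so `G` can be enlarged until it is
normal in `Dˣ`, where a Cartan-Brauer-Hua argument makes it central. -/

/-! ### The map `v ↦ v / s v` on a field. -/

open Polynomial in
theorem exists_fraction_iterate_div_map {M : Type*} [Field M] (s : M →+* M) {x z : M}
    (hsx : s x = z * x) (hsz : s z = z) (hx : 1 + x ≠ 0) (hz : ∀ n : ℕ, 0 < n → z ^ n ≠ 1)
    (N : ℕ) :
    ∃ A B : M[X], A.map s = A ∧ B.map s = B ∧ A.eval (-1) = 0 ∧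
      (∀ j : ℕ, A.eval (-z ^ (j + 1)) ≠ 0) ∧ (∀ j : ℕ, B.eval (-z ^ j) ≠ 0) ∧
      A.eval x ≠ 0 ∧ B.eval x ≠ 0 ∧
      (fun v => v / s v)^[N] (1 + x) = A.eval x / B.eval x := by
  induction N with
  | zero =>
    refine ⟨1 + X, 1, by simp, by simp, by simp, fun j h => ?_, by simp, by simpa using hx,
      by simp, by simp⟩
    simp only [eval_add, eval_one, eval_X] at h
    exact hz (j + 1) j.succ_pos (by linear_combination -h)
  | succ N ih =>
    obtain ⟨A, B, hA, hB, hA1, hAj, hBj, hAx, hBx, h⟩ := ih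
    have key : ∀ P : M[X], P.map s = P → (P.comp (C z * X)).eval x = s (P.eval x) := by
      intro P hP
      conv_rhs => rw [← Polynomial.eval_map_apply, hP, hsx]
      simp
    have ev : ∀ (P : M[X]) (j : ℕ), (P.comp (C z * X)).eval (-z ^ j) = P.eval (-z ^ (j + 1)) := by
      intro P j
      simp [pow_succ']
    have s0 : ∀ a : M, a ≠ 0 → s a ≠ 0 := fun a ha => by simpa using ha
    -- On polynomials with `s`-fixed coefficients, `s` acts as `X ↦ z * X`, which shifts the points
    -- `-z ^ j` by one. Hence the zero of `A` at `-1` is never cancelled by `B`.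
    refine ⟨A * B.comp (C z * X), B * A.comp (C z * X), ?_, ?_, ?_, ?_, ?_, ?_, ?_, ?_⟩
    · simp [Polynomial.map_comp, hA, hB, hsz]
    · simp [Polynomial.map_comp, hA, hB, hsz]
    · rw [eval_mul, hA1, zero_mul]
    · intro j
      rw [eval_mul, ev]
      exact mul_ne_zero (hAj j) (hBj _)
    · intro j
      rw [eval_mul, ev]
      exact mul_ne_zero (hBj j) (hAj _)
    · rw [eval_mul, key B hB]
      exact mul_ne_zero hAx (s0 _ hBx)
    · rw [eval_mul, key A hA]
      exact mul_ne_zero hBx (s0 _ hAx)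
    · rw [Function.iterate_succ_apply', h, eval_mul, eval_mul, key A hA, key B hB, map_div₀]
      have := s0 _ hAx
      have := s0 _ hBx
      field_simp

-- If `z` were not a root of unity, `A - B` would be nonzero at `-1`, yet vanish on the whole
-- infinite `s`-orbit `z ^ i * x`.
open Polynomial in
theorem exists_pow_eq_one_of_iterate_div_map_eq_one {M : Type*} [Field M] (s : M →+* M) {x z : M}
    (hsx : s x = z * x) (hsz : s z = z) (hx0 : x ≠ 0) (hx : 1 + x ≠ 0) (N : ℕ)
    (hN : (fun v => v / s v)^[N] (1 + x) = 1) :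
    ∃ n : ℕ, 0 < n ∧ z ^ n = 1 := by
  by_contra! hz
  obtain ⟨A, B, hA, hB, hA1, -, hBj, hAx, hBx, h⟩ :=
    exists_fraction_iterate_div_map s hsx hsz hx hz N
  have hAB : A.eval x = B.eval x := by
    rw [hN] at h
    field_simp at h
    exact h.symm
  have hne : A - B ≠ 0 := by
    intro h0
    apply hBj 0
    have := congrArg (eval (-1)) h0
    rw [eval_sub, hA1, eval_zero] at this
    simpa using this
  have hroot : ∀ i : ℕ, (A - B).eval (z ^ i * x) = 0 := by
    intro i
    induction i with
    | zero => simp [hAB]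
    | succ i ih =>
      have h1 : s ((A - B).eval (z ^ i * x)) = 0 := by rw [ih, map_zero]
      rw [← Polynomial.eval_map_apply, Polynomial.map_sub, hA, hB, map_mul, map_pow, hsz, hsx] at h1
      rw [pow_succ, mul_assoc]
      exact h1
  have hz0 : z ≠ 0 := by
    rintro rfl
    rw [zero_mul, map_eq_zero] at hsx
    exact hx0 hsx
  have hinj : Function.Injective fun i : ℕ => z ^ i * x := by
    intro i j hij
    have hij' : z ^ i = z ^ j := mul_right_cancel₀ hx0 hij
    by_contra hne
    wlog hlt : i < j generalizing i j
    · exact this hij.symm hij'.symm (Ne.symm hne) (by omega)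
    apply hz (j - i) (by omega)
    have : z ^ i * z ^ (j - i) = z ^ i * 1 := by rw [← pow_add, mul_one, hij']; congr 1; omega
    exact mul_left_cancel₀ (pow_ne_zero _ hz0) this
  exact hne (Polynomial.eq_zero_of_infinite_isRoot _
    ((Set.infinite_range_of_injective hinj).mono (by rintro _ ⟨i, rfl⟩; exact hroot i)))

theorem iterate_div_map_pow {M : Type*} [Field M] (s : M →+* M) (u : M) (k n : ℕ) :
    (fun v => v / s v)^[n] (u ^ k) = ((fun v => v / s v)^[n] u) ^ k := by
  induction n with
  | zero => rfl
  | succ n ih => rw [Function.iterate_succ_apply', Function.iterate_succ_apply', ih]; simp [div_pow]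

theorem iterate_map_iterate_div_map {M : Type*} [Field M] (s : M →+* M) (u : M) (m n : ℕ)
    (h : s^[m] u = u) : s^[m] ((fun v => v / s v)^[n] u) = (fun v => v / s v)^[n] u := by
  have hc : Function.Commute s fun v => v / s v := fun v => map_div₀ s v (s v)
  rw [(hc.iterate_iterate m n).eq, h]

/-- The last nontrivial quotient `v / s v` is fixed by `s`, so going once round the period `m` of
`v` shows that its `m`-th power is 1. Thus `u ^ m` reaches 1 one step sooner than `u`. -/
theorem div_map_pow_eq_one {M : Type*} [Field M] (s : M →+* M) (m N : ℕ) (u : M) (hu : u ≠ 0)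
    (hm : s^[m] u = u) (hN : (fun v => v / s v)^[N + 1] u = 1) : (u / s u) ^ m ^ N = 1 := by
  induction N generalizing u with
  | zero => simpa using hN
  | succ N ih =>
    set v := (fun v => v / s v)^[N] u with hv
    have hv0 : v ≠ 0 := by
      have : ∀ n, (fun v => v / s v)^[n] u ≠ 0 := by
        intro n
        induction n with
        | zero => exact hu
        | succ n ih => rw [Function.iterate_succ_apply']; exact div_ne_zero ih (by simpa using ih)
      exact this N
    have hvm : s^[m] v = v := iterate_map_iterate_div_map s u m N hm
    have h2 : (v / s v) / s (v / s v) = 1 := by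
      rw [Function.iterate_succ_apply', Function.iterate_succ_apply'] at hN
      exact hN
    have hs0 : s v ≠ 0 := by simpa using hv0
    have hw0 : s (v / s v) ≠ 0 := by simpa using hv0
    have hfix : s (v / s v) = v / s v := ((div_eq_one_iff_eq hw0).1 h2).symm
    have hpow : ∀ n : ℕ, (v / s v) ^ n * s^[n] v = v := by
      intro n
      induction n with
      | zero => simp
      | succ n ih =>
        rw [Function.iterate_succ_apply']
        have h3 := congrArg s ih
        rw [map_mul, map_pow, hfix] at h3
        rw [pow_succ', mul_assoc, h3]
        field_simp
    have hw : (v / s v) ^ m = 1 := by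
      have := hpow m
      rw [hvm] at this
      exact mul_right_cancel₀ hv0 (by rw [this, one_mul])
    have := ih (u ^ m) (pow_ne_zero _ hu) (by rw [iterate_map_pow, hm]) (by
      rw [iterate_div_map_pow, Function.iterate_succ_apply']
      exact hw)
    rw [map_pow, ← div_pow, ← pow_mul] at this
    rw [pow_succ']
    exact this

theorem exists_pow_eq_one_of_isIntegral_zmod {M : Type*} [Field M] {q : ℕ} [Fact q.Prime]
    [Algebra (ZMod q) M] {x : M} (hx : IsIntegral (ZMod q) x) (hx0 : x ≠ 0) :
    ∃ n : ℕ, 0 < n ∧ x ^ n = 1 := by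
  have := IntermediateField.adjoin.finiteDimensional hx
  have : Finite (IntermediateField.adjoin (ZMod q) {x}) := Module.finite_of_finite (ZMod q)
  let g : IntermediateField.adjoin (ZMod q) {x} := IntermediateField.AdjoinSimple.gen (ZMod q) x
  have hg : g ≠ 0 := by
    intro h
    apply hx0
    have := congrArg (algebraMap _ M) h
    simpa [g] using this
  obtain ⟨n, hn, h⟩ := isOfFinOrder_iff_pow_eq_one.1 (isOfFinOrder_of_finite (Units.mk0 g hg))
  refine ⟨n, hn, ?_⟩
  have h1 : g ^ n = 1 := by simpa [Units.ext_iff] using h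
  have := congrArg (algebraMap _ M) h1
  simpa [g] using this

theorem isIntegral_of_pow_eq_one {R M : Type*} [CommRing R] [CommRing M] [Algebra R M] {x : M}
    {n : ℕ} (hn : 0 < n) (h : x ^ n = 1) : IsIntegral R x :=
  IsIntegral.of_pow hn (h ▸ isIntegral_one)

theorem exists_charP_of_iterate_div_map_eq_one {M : Type*} [Field M] (s : M →+* M) {x z : M}
    (hsx : s x = z * x) (hsz : s z = z) (hx0 : x ≠ 0) (hz1 : z ≠ 1)
    (hE : ∀ u : M, u ≠ 0 → ∃ N : ℕ, (fun v => v / s v)^[N] u = 1) :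
    ∃ q : ℕ, q.Prime ∧ CharP M q ∧ (∃ n : ℕ, 0 < n ∧ x ^ n = 1) ∧ ∃ n : ℕ, 0 < n ∧ z ^ n = 1 := by
  have hsum : ∀ c : ℕ, 1 + (c : M) * x ≠ 0 := by
    intro c h
    have h1 := congrArg s h
    simp only [map_add, map_one, map_mul, map_natCast, map_zero, hsx] at h1
    have hc : (c : M) ≠ 0 := by rintro h0; simp [h0] at h
    have : (c : M) * x * (z - 1) = 0 := by linear_combination h1 - h
    simp [hc, hx0, sub_eq_zero, hz1] at this
  obtain ⟨m, hm0, hm⟩ : ∃ n : ℕ, 0 < n ∧ z ^ n = 1 := by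
    obtain ⟨N, hN⟩ := hE (1 + x) (by simpa using hsum 1)
    exact exists_pow_eq_one_of_iterate_div_map_eq_one s hsx hsz hx0 (by simpa using hsum 1) N hN
  have hiter : ∀ n : ℕ, s^[n] x = z ^ n * x := by
    intro n
    induction n with
    | zero => simp
    | succ n ih => rw [Function.iterate_succ_apply', ih, map_mul, map_pow, hsz, hsx, pow_succ,
        mul_assoc]
  -- The last relation can be solved for `c * x`: with `c = 1` it makes `x` algebraic over any
  -- subfield, and in characteristic 0 it makes `e` determine `c`.
  have heps : ∀ c : ℕ, ∃ e : M, e = (1 + c * x) / (1 + c * (z * x)) ∧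
      (∃ n : ℕ, 0 < n ∧ e ^ n = 1) ∧ c * x * (1 - e * z) = e - 1 := by
    intro c
    have hsu : s (1 + c * x) = 1 + c * (z * x) := by simp [hsx]
    have hs0 : 1 + (c : M) * (z * x) ≠ 0 := by
      rw [← hsu]; exact (map_ne_zero s).2 (hsum c)
    refine ⟨_, rfl, ?_, ?_⟩
    · obtain ⟨N, hN⟩ := hE (1 + c * x) (hsum c)
      refine ⟨m ^ N, pow_pos hm0 N, ?_⟩
      rw [← hsu]
      refine div_map_pow_eq_one s m N _ (hsum c) ?_ ?_
      · have h1 : ∀ n : ℕ, s^[n] (1 + c * x) = 1 + c * s^[n] x := by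
          intro n
          induction n with
          | zero => rfl
          | succ n ih => simp only [Function.iterate_succ_apply', ih, map_add, map_one, map_mul,
              map_natCast]
        rw [h1, hiter, hm, one_mul]
      · rw [Function.iterate_succ_apply', hN]; simp
    · linear_combination -(div_mul_cancel₀ (1 + (c : M) * x) hs0)
  have hden : ∀ (c : ℕ) (e : M), (c : M) ≠ 0 → c * x * (1 - e * z) = e - 1 → 1 - e * z ≠ 0 := by
    intro c e hc h h0
    rw [h0, mul_zero] at h
    have : e = 1 := by linear_combination -h
    rw [this, one_mul, sub_eq_zero] at h0
    exact hz1 h0.symm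
  have hint : ∀ (F : Type) [Field F] [Algebra F M], IsIntegral F x ∧ IsIntegral F z := by
    intro F _ _
    have hzi : IsIntegral F z := isIntegral_of_pow_eq_one hm0 hm
    refine ⟨?_, hzi⟩
    obtain ⟨e, -, ⟨n, hn, hen⟩, h⟩ := heps 1
    have hei : IsIntegral F e := isIntegral_of_pow_eq_one hn hen
    have h0 := hden 1 e (by simp) h
    have hx : x = (e - 1) * (1 - e * z)⁻¹ := by
      field_simp
      simpa using h
    rw [hx]
    exact (hei.sub isIntegral_one).mul (isIntegral_one.sub (hei.mul hzi)).inv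
  obtain ⟨q, hq⟩ := CharP.exists M
  rcases CharP.char_is_prime_or_zero M q with hp | rfl
  · have : Fact q.Prime := ⟨hp⟩
    let _ : Algebra (ZMod q) M := ZMod.algebra M q
    exact ⟨q, hp, hq, exists_pow_eq_one_of_isIntegral_zmod (hint (ZMod q)).1 hx0, m, hm0, hm⟩
  · exfalso
    have : CharZero M := CharP.charP_to_charZero M
    let L := IntermediateField.adjoin ℚ ({x, z} : Set M)
    have hfd : FiniteDimensional ℚ L := by
      apply IntermediateField.finiteDimensional_adjoin
      intro y hy
      rcases hy with rfl | rfl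
      exacts [(hint ℚ).1, (hint ℚ).2]
    have : NumberField L := ⟨⟩
    have hxL : x ∈ L := IntermediateField.subset_adjoin ℚ _ (by simp)
    have hzL : z ∈ L := IntermediateField.subset_adjoin ℚ _ (by simp)
    choose e he1 he2 he3 using heps
    have heL : ∀ c, e c ∈ L := by
      intro c
      rw [he1]
      exact L.div_mem (L.add_mem L.one_mem (L.mul_mem (natCast_mem L c) hxL))
        (L.add_mem L.one_mem (L.mul_mem (natCast_mem L c) (L.mul_mem hzL hxL)))
    -- Only finitely many integers of `L` have all conjugates in the unit disc, but the `e c` are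
    -- infinitely many roots of unity in `L`.
    have hfin := NumberField.Embeddings.finite_of_norm_le L ℂ 1
    refine Set.infinite_of_injective_forall_mem (f := fun c : ℕ => (⟨e (c + 1), heL _⟩ : L))
      ?_ ?_ hfin
    · intro a b hab
      have hab' : e (a + 1) = e (b + 1) := congrArg Subtype.val hab
      have ha := he3 (a + 1)
      have hb := he3 (b + 1)
      have h0 := hden _ _ (by exact_mod_cast a.succ_ne_zero) ha
      rw [← hab', ← ha] at hb
      have := mul_right_cancel₀ hx0 (mul_right_cancel₀ h0 hb)
      have := Nat.cast_injective this
      omega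
    · intro c
      obtain ⟨n, hn, h⟩ := he2 (c + 1)
      have hL : (⟨e (c + 1), heL _⟩ : L) ^ n = 1 := Subtype.ext h
      refine ⟨isIntegral_of_pow_eq_one hn hL, fun φ => ?_⟩
      have : φ ⟨e (c + 1), heL _⟩ ^ n = 1 := by rw [← map_pow, hL, map_one]
      exact (Complex.norm_eq_one_of_pow_eq_one this hn.ne').le

/-! ### Engel pairs with central commutator in a division ring. -/

theorem commute_of_mem_subfield_closure {D : Type*} [DivisionRing D] {s : Set D}
    (hs : ∀ a ∈ s, ∀ b ∈ s, a * b = b * a) {a b : D} (ha : a ∈ Subfield.closure s)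
    (hb : b ∈ Subfield.closure s) : Commute a b := by
  have step : ∀ t : Set D, ∀ b : D, (∀ a ∈ t, Commute a b) →
      ∀ a ∈ Subfield.closure t, Commute a b := by
    intro t b ht a ha
    induction ha using Subfield.closure_induction with
    | mem x hx => exact ht x hx
    | one => exact Commute.one_left b
    | add x y _ _ hx hy => exact hx.add_left hy
    | neg x _ hx => exact hx.neg_left
    | inv x _ hx => exact hx.inv_left₀
    | mul x y _ _ hx hy => exact hx.mul_left hy
  exact step s b (fun c hc => (step s c (fun d hd => hs d hd c hc) b hb).symm) a ha

theorem exists_charP_of_iterate_commutator_eq_one {D : Type*} [DivisionRing D] {x y z : Dˣ}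
    (hxz : y * x * y⁻¹ = z * x) (hzx : Commute z x) (hzy : Commute z y) (hz1 : z ≠ 1)
    (hE : ∀ u : Dˣ, ∃ N : ℕ, (fun v => ⁅v, y⁆)^[N] u = 1) :
    ∃ q : ℕ, q.Prime ∧ CharP D q ∧ (∃ n : ℕ, 0 < n ∧ x ^ n = 1) ∧ ∃ n : ℕ, 0 < n ∧ z ^ n = 1 := by
  let K : Subfield D := Subfield.closure {(x : D), (z : D)}
  have hzx' : (z : D) * x = x * z := by exact_mod_cast congrArg Units.val hzx.eq
  have hcomm : ∀ a b : K, a * b = b * a := by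
    intro a b
    apply Subtype.ext
    refine (commute_of_mem_subfield_closure ?_ a.2 b.2).eq
    rintro _ (rfl | rfl) _ (rfl | rfl)
    exacts [rfl, hzx'.symm, hzx', rfl]
  let _ : Field K := { (inferInstance : DivisionRing K) with mul_comm := hcomm }
  let conj : D →+* D := (MulSemiringAction.toRingEquiv (ConjAct Dˣ) D (ConjAct.toConjAct y))
  have hconj : ∀ d, conj d = y * d * (y⁻¹ : Dˣ) := fun d => rfl
  have hcx : conj (x : D) = z * x := by
    rw [hconj]; exact_mod_cast congrArg Units.val hxz
  have hcz : conj (z : D) = z := by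
    have : y * z * y⁻¹ = z := by rw [← hzy.eq, mul_inv_cancel_right]
    rw [hconj]; exact_mod_cast congrArg Units.val this
  have hxK : (x : D) ∈ K := Subfield.subset_closure (by simp)
  have hzK : (z : D) ∈ K := Subfield.subset_closure (by simp)
  have hle : K ≤ K.comap conj := by
    refine Subfield.closure_le.2 ?_
    rintro _ (rfl | rfl)
    · change conj _ ∈ K
      rw [hcx]
      exact K.mul_mem hzK hxK
    · change conj _ ∈ K
      rwa [hcz]
  let s : K →+* K := (conj.comp K.subtype).codRestrict K fun a => hle a.2
  have hs : ∀ a : K, (s a : D) = conj a := fun a => rfl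
  have key : ∀ (N : ℕ) (w : Dˣ) (u : K), (w : D) = u →
      (((fun v => ⁅v, y⁆)^[N] w : Dˣ) : D) = ((fun v => v / s v)^[N] u : K) := by
    intro N w u hwu
    induction N with
    | zero => exact hwu
    | succ N ih =>
      rw [Function.iterate_succ_apply', Function.iterate_succ_apply']
      set a := (fun v => ⁅v, y⁆)^[N] w
      set b := (fun v => v / s v)^[N] u
      change _ = (b : D) / ((s b : K) : D)
      rw [hs, hconj, ← ih, commutatorElement_def, div_eq_mul_inv]
      simp only [Units.val_mul, Units.val_inv_eq_inv_val, mul_inv_rev, inv_inv, mul_assoc]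
  obtain ⟨q, hq, hK, ⟨n, hn, hxn⟩, ⟨m, hm, hzm⟩⟩ :=
    exists_charP_of_iterate_div_map_eq_one s (x := ⟨x, hxK⟩) (z := ⟨z, hzK⟩)
      (Subtype.ext hcx) (Subtype.ext hcz) (fun h => x.ne_zero (congrArg Subtype.val h))
      (fun h => hz1 (Units.ext (congrArg Subtype.val h)))
      (by
        intro u hu
        have hu' : (u : D) ≠ 0 := fun h => hu (Subtype.ext h)
        obtain ⟨N, hN⟩ := hE (Units.mk0 (u : D) hu')
        refine ⟨N, Subtype.ext ?_⟩
        rw [← key N (Units.mk0 (u : D) hu') u rfl, hN]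
        rfl)
  refine ⟨q, hq, charP_of_injective_ringHom K.subtype.injective q, ⟨n, hn, ?_⟩, ⟨m, hm, ?_⟩⟩
  · exact Units.ext (by simpa using congrArg Subtype.val hxn)
  · exact Units.ext (by simpa using congrArg Subtype.val hzm)

/-- The span of `S` over the prime field is a finite ring without zero divisors, hence a field by
Wedderburn. -/
theorem commute_of_finite_submonoid {D : Type*} [DivisionRing D] {q : ℕ} (hq : q.Prime)
    [CharP D q] (S : Submonoid D) (hS : (S : Set D).Finite) {a b : D} (ha : a ∈ S) (hb : b ∈ S) :
    Commute a b := by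
  have : Fact q.Prime := ⟨hq⟩
  let _ : Algebra (ZMod q) D := ZMod.algebra D q
  let R := Algebra.adjoin (ZMod q) (S : Set D)
  have hspan : Subalgebra.toSubmodule R = Submodule.span (ZMod q) (S : Set D) := by
    rw [Algebra.adjoin_eq_span, Submonoid.closure_eq]
  have : Module.Finite (ZMod q) R := by
    have h : Module.Finite (ZMod q) (Subalgebra.toSubmodule R) := by
      rw [hspan]
      exact Module.Finite.span_of_finite _ hS
    exact h
  have : Finite R := Module.finite_of_finite (ZMod q)
  have hc := (Finite.isDomain_to_isField R).mul_comm
    ⟨a, Algebra.subset_adjoin ha⟩ ⟨b, Algebra.subset_adjoin hb⟩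
  exact congrArg Subtype.val hc

/-- Moving `y` past `x` costs only a power of `z`, so all words have the normal form `z ^ k * x ^ i
* y ^ j`. -/
theorem finite_submonoid_closure_pair {G : Type*} [Group G] {x y z : G}
    (hxz : y * x = z * x * y) (hzx : Commute z x) (hzy : Commute z y)
    (hx : IsOfFinOrder x) (hy : IsOfFinOrder y) (hz : IsOfFinOrder z) :
    (Submonoid.closure {x, y} : Set G).Finite := by
  have hyx : ∀ i j : ℕ, y ^ j * x ^ i = z ^ (j * i) * x ^ i * y ^ j := by
    intro i j
    have h1 : ∀ i : ℕ, y * x ^ i = z ^ i * x ^ i * y := by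
      intro i
      induction i with
      | zero => simp
      | succ i ih =>
        calc y * x ^ (i + 1) = y * x ^ i * x := by rw [pow_succ, mul_assoc]
          _ = z ^ i * x ^ i * (y * x) := by rw [ih, mul_assoc]
          _ = z ^ i * (x ^ i * z) * x * y := by rw [hxz]; simp only [mul_assoc]
          _ = z ^ (i + 1) * x ^ (i + 1) * y := by
            rw [← (hzx.pow_right i).eq, pow_succ, pow_succ]; simp only [mul_assoc]
    induction j with
    | zero => simp
    | succ j ih =>
      calc y ^ (j + 1) * x ^ i = y * (y ^ j * x ^ i) := by rw [pow_succ', mul_assoc]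
        _ = (y * z ^ (j * i)) * x ^ i * y ^ j := by rw [ih]; simp only [mul_assoc]
        _ = z ^ (j * i) * (y * x ^ i) * y ^ j := by
          rw [← (hzy.pow_left (j * i)).eq]; simp only [mul_assoc]
        _ = z ^ ((j + 1) * i) * x ^ i * y ^ (j + 1) := by
          rw [h1, add_mul, one_mul, pow_add, pow_succ' y]; simp only [mul_assoc]
  let S : Submonoid G :=
    { carrier := {g | ∃ k i j : ℕ, g = z ^ k * x ^ i * y ^ j}
      one_mem' := ⟨0, 0, 0, by simp⟩
      mul_mem' := by
        rintro _ _ ⟨k, i, j, rfl⟩ ⟨k', i', j', rfl⟩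
        refine ⟨k + k' + j * i', i + i', j + j', ?_⟩
        have e1 : y ^ j * z ^ k' = z ^ k' * y ^ j := ((hzy.pow_pow k' j).eq).symm
        have e2 : x ^ i * z ^ (k' + j * i') = z ^ (k' + j * i') * x ^ i :=
          ((hzx.pow_pow _ i).eq).symm
        calc z ^ k * x ^ i * y ^ j * (z ^ k' * x ^ i' * y ^ j')
            = z ^ k * x ^ i * (y ^ j * z ^ k') * x ^ i' * y ^ j' := by simp only [mul_assoc]
          _ = z ^ k * x ^ i * z ^ k' * (y ^ j * x ^ i') * y ^ j' := by
            rw [e1]; simp only [mul_assoc]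
          _ = z ^ k * (x ^ i * z ^ (k' + j * i')) * x ^ i' * y ^ j * y ^ j' := by
            rw [hyx, pow_add]; simp only [mul_assoc]
          _ = z ^ (k + k' + j * i') * x ^ (i + i') * y ^ (j + j') := by
            rw [e2, add_assoc, pow_add z k, pow_add x, pow_add y]; simp only [mul_assoc] }
  have hle : Submonoid.closure {x, y} ≤ S := by
    refine Submonoid.closure_le.2 ?_
    rintro _ (rfl | rfl)
    exacts [⟨0, 1, 0, by simp⟩, ⟨0, 0, 1, by simp⟩]
  have hfin : ∀ g : G, IsOfFinOrder g → (Submonoid.powers g : Set G).Finite :=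
    fun g hg => finite_powers.2 hg
  refine ((((hfin z hz).mul (hfin x hx)).mul (hfin y hy)).subset ?_).subset hle
  rintro _ ⟨k, i, j, rfl⟩
  exact Set.mul_mem_mul (Set.mul_mem_mul ⟨k, rfl⟩ ⟨i, rfl⟩) ⟨j, rfl⟩

theorem commute_of_iterate_commutator_eq_one {D : Type*} [DivisionRing D] {x y : Dˣ}
    (hx : Commute ⁅y, x⁆ x) (hy : Commute ⁅y, x⁆ y)
    (hEx : ∀ u : Dˣ, ∃ N : ℕ, (fun v => ⁅v, x⁆)^[N] u = 1)
    (hEy : ∀ u : Dˣ, ∃ N : ℕ, (fun v => ⁅v, y⁆)^[N] u = 1) : Commute y x := by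
  by_contra hne
  set z := ⁅y, x⁆ with hz
  have hz1 : z ≠ 1 := fun h => hne (commutatorElement_eq_one_iff_commute.1 h)
  have hxz : y * x * y⁻¹ = z * x := by rw [hz, commutatorElement_def]; group
  have hyx : y * x = z * x * y := by rw [← hxz, inv_mul_cancel_right]
  have hyz : x * y * x⁻¹ = z⁻¹ * y := by
    have : x * y = z⁻¹ * (y * x) := by rw [hyx]; group
    rw [this]; group
  obtain ⟨q, hq, hD, ⟨n, hn, hxn⟩, ⟨m, hm, hzm⟩⟩ :=
    exists_charP_of_iterate_commutator_eq_one hxz hx hy hz1 hEy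
  -- The situation is symmetric under exchanging `x` and `y` and inverting `z`; this gives the
  -- finite order of `y`.
  obtain ⟨-, -, -, ⟨k, hk, hyk⟩, -⟩ :=
    exists_charP_of_iterate_commutator_eq_one hyz hy.inv_left hx.inv_left
      (inv_ne_one.2 hz1) hEx
  have hfin := finite_submonoid_closure_pair hyx hx hy (isOfFinOrder_iff_pow_eq_one.2 ⟨n, hn, hxn⟩)
    (isOfFinOrder_iff_pow_eq_one.2 ⟨k, hk, hyk⟩) (isOfFinOrder_iff_pow_eq_one.2 ⟨m, hm, hzm⟩)
  have hc := commute_of_finite_submonoid hq ((Submonoid.closure {x, y}).map (Units.coeHom D))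
    (by rw [Submonoid.coe_map]; exact hfin.image _)
    (Submonoid.mem_map_of_mem _ (Submonoid.subset_closure (by simp : y ∈ ({x, y} : Set Dˣ))))
    (Submonoid.mem_map_of_mem _ (Submonoid.subset_closure (by simp : x ∈ ({x, y} : Set Dˣ))))
  exact hne (Units.ext hc.eq)

/-! ### Engel conditions from subnormality and nilpotence; `G` is abelian. -/

theorem Subgroup.IsSubnormal.exists_iterate_commutator_mem {G : Type*} [Group G] {A : Subgroup G}
    (hA : A.IsSubnormal) {y : G} (hy : y ∈ A) (u : G) :
    ∃ N : ℕ, (fun v => ⁅v, y⁆)^[N] u ∈ A := by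
  induction hA with
  | top => exact ⟨0, trivial⟩
  | step H K hle _ hN ih =>
    obtain ⟨N, h⟩ := ih (hle hy)
    refine ⟨N + 1, ?_⟩
    rw [Function.iterate_succ_apply', commutatorElement_def]
    exact H.mul_mem (hN.conj_mem ⟨y, hle hy⟩ hy ⟨_, h⟩) (H.inv_mem hy)

theorem exists_iterate_commutator_eq_one_of_mem {G : Type*} [Group G] {A : Subgroup G}
    (hA : A.IsSubnormal) (y : G) (hy : y ∈ A)
    (h : ∀ a ∈ A, ∃ N : ℕ, (fun v => ⁅v, y⁆)^[N] a = 1) (u : G) :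
    ∃ N : ℕ, (fun v => ⁅v, y⁆)^[N] u = 1 := by
  obtain ⟨N, hN⟩ := hA.exists_iterate_commutator_mem hy u
  obtain ⟨M, hM⟩ := h _ hN
  exact ⟨M + N, by rw [Function.iterate_add_apply, hM]⟩

theorem exists_iterate_commutator_eq_one_of_isNilpotent {G : Type*} [Group G] [Group.IsNilpotent G]
    (y u : G) : ∃ N : ℕ, (fun v => ⁅v, y⁆)^[N] u = 1 := by
  obtain ⟨n, hn⟩ := Subgroup.nilpotent_iff_lowerCentralSeries.1 (inferInstance : Group.IsNilpotent G)
  have : ∀ k, (fun v => ⁅v, y⁆)^[k] u ∈ (⊤ : Subgroup G).lowerCentralSeries k := by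
    intro k
    induction k with
    | zero => trivial
    | succ k ih =>
      rw [Function.iterate_succ_apply', Subgroup.lowerCentralSeries_succ]
      exact Subgroup.commutator_mem_commutator ih trivial
  exact ⟨n, by simpa [hn] using this n⟩

/-- Take `x` in the second centre but not in the centre, and any `y` that does not commute with it.
-/
theorem exists_commutator_mem_center_of_isNilpotent {G : Type*} [Group G] [Group.IsNilpotent G]
    {a b : G} (hab : ¬ Commute a b) : ∃ x y : G, ⁅y, x⁆ ∈ Subgroup.center G ∧ ¬ Commute y x := by
  have hne : Nontrivial (G ⧸ Subgroup.center G) := by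
    refine ⟨(a : G ⧸ Subgroup.center G), 1, fun h => hab ?_⟩
    have := (QuotientGroup.eq_one_iff a).1 h
    exact (Subgroup.mem_center_iff.1 this b).symm
  obtain ⟨c, hc, hc1⟩ := (Subgroup.ne_bot_iff_exists_ne_one.1
    (Group.IsNilpotent.center_ne_bot (G := G ⧸ Subgroup.center G))) |>.elim
      fun c hc => (⟨c.1, c.2, fun h => hc (Subtype.ext h)⟩ :
        ∃ c : G ⧸ Subgroup.center G, c ∈ Subgroup.center (G ⧸ Subgroup.center G) ∧ c ≠ 1)
  obtain ⟨x, rfl⟩ := QuotientGroup.mk_surjective c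
  have hx : x ∉ Subgroup.center G := fun h => hc1 ((QuotientGroup.eq_one_iff x).2 h)
  rw [Subgroup.mem_center_iff] at hx
  push Not at hx
  obtain ⟨y, hy⟩ := hx
  refine ⟨x, y, ?_, hy⟩
  rw [← QuotientGroup.eq_one_iff]
  have := Subgroup.mem_center_iff.1 hc (y : G ⧸ Subgroup.center G)
  exact commutatorElement_eq_one_iff_commute.2 this

theorem IsLocallyNilpotentGroup.commute_of_isSubnormal {D : Type*} [DivisionRing D]
    {G : Subgroup Dˣ} (hsub : G.IsSubnormal) (hnil : IsLocallyNilpotentGroup G) {a b : Dˣ}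
    (ha : a ∈ G) (hb : b ∈ G) : Commute a b := by
  have hE : ∀ y ∈ G, ∀ u : Dˣ, ∃ N : ℕ, (fun v => ⁅v, y⁆)^[N] u = 1 := by
    intro y hy
    refine exists_iterate_commutator_eq_one_of_mem hsub y hy fun u hu => ?_
    let H : Subgroup G := Subgroup.closure {⟨u, hu⟩, ⟨y, hy⟩}
    have : Group.IsNilpotent H := hnil H ((Subgroup.fg_iff _).2 ⟨_, rfl, by simp⟩)
    obtain ⟨N, hN⟩ := exists_iterate_commutator_eq_one_of_isNilpotent
      (⟨⟨y, hy⟩, Subgroup.subset_closure (by simp)⟩ : H) ⟨⟨u, hu⟩, Subgroup.subset_closure (by simp)⟩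
    refine ⟨N, ?_⟩
    have hsemi : Function.Semiconj (fun h : H => ((h : G) : Dˣ))
      (fun v => ⁅v, (⟨⟨y, hy⟩, Subgroup.subset_closure (by simp)⟩ : H)⁆) (fun v => ⁅v, y⁆) :=
      fun v => rfl
    have := (hsemi.iterate_right N) ⟨⟨u, hu⟩, Subgroup.subset_closure (by simp)⟩
    rw [hN] at this
    exact this.symm
  by_contra hab
  let H : Subgroup G := Subgroup.closure {⟨a, ha⟩, ⟨b, hb⟩}
  have : Group.IsNilpotent H := hnil H ((Subgroup.fg_iff _).2 ⟨_, rfl, by simp⟩)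
  obtain ⟨x, y, hz, hxy⟩ := exists_commutator_mem_center_of_isNilpotent (G := H)
    (a := ⟨⟨a, ha⟩, Subgroup.subset_closure (by simp)⟩)
    (b := ⟨⟨b, hb⟩, Subgroup.subset_closure (by simp)⟩)
    (fun h => hab (congrArg (fun h : H => ((h : G) : Dˣ)) h.eq))
  have hc : ∀ w : H, Commute ⁅((y : G) : Dˣ), ((x : G) : Dˣ)⁆ ((w : G) : Dˣ) := fun w =>
    congrArg (fun h : H => ((h : G) : Dˣ)) (Subgroup.mem_center_iff.1 hz w).symm
  have := commute_of_iterate_commutator_eq_one (hc x) (hc y) (hE _ x.1.2) (hE _ y.1.2)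
  exact hxy (Subtype.ext (Subtype.ext this.eq))

/-! ### Abelian subnormal subgroups are central. -/

/-- The Cartan-Brauer-Hua argument for an element commuting with all its conjugates. -/
theorem commute_of_forall_commute_conj {D : Type*} [DivisionRing D] {y : Dˣ}
    (hy : ∀ u : Dˣ, Commute (u * y * u⁻¹) y) (d : D) : Commute (y : D) d := by
  have hk : ∀ d : D, d ≠ 0 → ∃ b : D, (y : D) * d = b * d * y ∧ Commute (y : D) b := by
    intro d hd
    let u : Dˣ := Units.mk0 d hd
    refine ⟨((y * (u * y * u⁻¹)⁻¹ : Dˣ) : D), ?_, ?_⟩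
    · have : y * u = y * (u * y * u⁻¹)⁻¹ * u * y := by group
      exact congrArg Units.val this
    · exact congrArg Units.val ((Commute.refl y).mul_right (hy u).symm.inv_right).eq
  rcases eq_or_ne d 0 with rfl | hd
  · exact Commute.zero_right _
  rcases eq_or_ne (1 + d) 0 with hd1 | hd1
  · rw [eq_neg_of_add_eq_zero_right hd1]
    exact (Commute.one_right _).neg_right
  obtain ⟨b, hb, hyb⟩ := hk d hd
  obtain ⟨b', hb', hyb'⟩ := hk (1 + d) hd1
  have hy0 : (y : D) ≠ 0 := y.ne_zero
  have h1 : 1 + b * d = b' + b' * d := by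
    apply mul_right_cancel₀ hy0
    rw [add_mul, ← hb, one_mul, ← mul_one_add, ← mul_one_add, ← hb']
  -- Either `b = b'`, and then both are 1, or `d` is a quotient of elements that commute with `y`.
  have h2 : (b - b') * d = b' - 1 := by
    rw [sub_mul, sub_eq_sub_iff_add_eq_add, add_comm, h1, add_comm]
  rcases eq_or_ne (b - b') 0 with h0 | h0
  · rw [h0, zero_mul, eq_comm, sub_eq_zero] at h2
    rw [sub_eq_zero, h2] at h0
    rw [h0, one_mul] at hb
    exact hb
  · have : d = (b - b')⁻¹ * (b' - 1) := by rw [← h2, inv_mul_cancel_left₀ h0]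
    rw [this]
    exact (hyb.sub_right hyb').inv_right₀.mul_right (hyb'.sub_right (Commute.one_right _))

/-- Separating `G` from the subnormal group `A` that normalizes it lets the induction climb the
chain: `G` is replaced by the subgroup generated by its `B`-conjugates, which lies in `A` and is
normalized by `B`. -/
theorem mem_center_of_isSubnormal_of_commute {D : Type*} [DivisionRing D] {A : Subgroup Dˣ}
    (hA : A.IsSubnormal) (G : Subgroup Dˣ) (hGA : G ≤ A)
    (hconj : ∀ a ∈ A, ∀ g ∈ G, a * g * a⁻¹ ∈ G) (hcomm : ∀ g ∈ G, ∀ h ∈ G, Commute g h) :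
    ∀ g ∈ G, (g : D) ∈ Subring.center D := by
  induction hA generalizing G with
  | top =>
    intro g hg
    rw [Subring.mem_center_iff]
    intro d
    exact (commute_of_forall_commute_conj
      (fun u => hcomm _ (hconj u trivial g hg) g hg) d).eq.symm
  | step A B hle hB hN ih =>
    have hA : A.IsSubnormal := .step A B hle hB hN
    have hAconj : ∀ b ∈ B, ∀ a ∈ A, b * a * b⁻¹ ∈ A := fun b hb a ha =>
      hN.conj_mem ⟨a, hle ha⟩ ha ⟨b, hb⟩
    have hE : ∀ b ∈ B, ∀ g ∈ G, ∀ u : Dˣ, ∃ N : ℕ, (fun v => ⁅v, b * g * b⁻¹⁆)^[N] u = 1 := by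
      intro b hb g hg
      refine exists_iterate_commutator_eq_one_of_mem hA _ (hAconj b hb g (hGA hg)) fun a ha => ?_
      -- Two steps suffice inside `A`: it normalizes `b G b⁻¹`, so the first commutator lies in this
      -- abelian group, which also contains `b * g * b⁻¹`.
      refine ⟨2, commutatorElement_eq_one_iff_commute.2 ?_⟩
      have h1 : b⁻¹ * a * b ∈ A := by
        simpa using hAconj b⁻¹ (B.inv_mem hb) a ha
      have h2 := (hcomm _ (G.mul_mem (hconj _ h1 g hg) (G.inv_mem hg)) g hg)
      have h3 := h2.map (MulAut.conj b).toMonoidHom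
      refine (congrArg₂ Commute ?_ ?_).mp h3
      · simp [commutatorElement_def, mul_assoc]
      · simp
    have hcc : ∀ b ∈ B, ∀ g ∈ G, ∀ h ∈ G, Commute (b * h * b⁻¹) g := by
      intro b hb g hg h hh
      have hxA : b * h * b⁻¹ ∈ A := hAconj b hb h (hGA hh)
      -- `G` and `b G b⁻¹` are both normalized by `A` and contained in it, so the commutator lies in
      -- their intersection and commutes with both elements.
      refine commute_of_iterate_commutator_eq_one ?_ ?_ ?_ (hE b hb h hh)
      · refine hcomm _ ?_ g hg
        exact G.mul_mem (hconj _ hxA g hg) (G.inv_mem hg)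
      · have h1 : b⁻¹ * g * b ∈ A := by
          simpa using hAconj b⁻¹ (B.inv_mem hb) g (hGA hg)
        have h2 := hcomm _ (G.mul_mem hh (hconj _ h1 _ (G.inv_mem hh))) h hh
        have h3 := h2.map (MulAut.conj b).toMonoidHom
        refine (congrArg₂ Commute ?_ ?_).mp h3
        · simp [commutatorElement_def, mul_assoc]
        · simp
      · have := hE 1 B.one_mem g hg
        simpa using this
    let S : Set Dˣ := {k | ∃ b ∈ B, ∃ g ∈ G, k = b * g * b⁻¹}
    have hS : ∀ x ∈ S, ∀ y ∈ S, x * y = y * x := by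
      rintro _ ⟨b, hb, h, hh, rfl⟩ _ ⟨c, hc, g, hg, rfl⟩
      have h1 := (hcc (c⁻¹ * b) (B.mul_mem (B.inv_mem hc) hb) g hg h hh).map
        (MulAut.conj c).toMonoidHom
      refine ((congrArg₂ Commute ?_ ?_).mp h1).eq
      · simp [mul_assoc]
      · simp
    have hSB : ∀ b ∈ B, ∀ k ∈ Subgroup.closure S, b * k * b⁻¹ ∈ Subgroup.closure S := by
      intro b hb
      have : Subgroup.closure S ≤ (Subgroup.closure S).comap (MulAut.conj b).toMonoidHom := by
        refine (Subgroup.closure_le _).2 ?_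
        rintro _ ⟨c, hc, g, hg, rfl⟩
        exact Subgroup.subset_closure ⟨b * c, B.mul_mem hb hc, g, hg, by simp [mul_assoc]⟩
      exact fun k hk => this hk
    have hGS : ∀ g ∈ G, g ∈ Subgroup.closure S := fun g hg =>
      Subgroup.subset_closure ⟨1, B.one_mem, g, hg, by simp⟩
    refine fun g hg => ih (Subgroup.closure S) ?_ hSB ?_ g (hGS g hg)
    · refine (Subgroup.closure_le _).2 ?_
      rintro _ ⟨c, hc, g, hg, rfl⟩
      exact hle (hAconj c hc g (hGA hg))
    · have := Subgroup.isMulCommutative_closure hS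
      intro x hx y hy
      exact congrArg Subtype.val (mul_comm' (⟨x, hx⟩ : Subgroup.closure S) ⟨y, hy⟩)

theorem theorem1 {D : Type*} [DivisionRing D] (G : Subgroup Dˣ)
    (hsub : G.IsSubnormal) (hnil : IsLocallyNilpotentGroup G) :
    ∀ g ∈ G, (g : D) ∈ Subring.center D :=
  mem_center_of_isSubnormal_of_commute hsub G le_rfl
    (fun _ ha _ hg => G.mul_mem (G.mul_mem ha hg) (G.inv_mem ha))
    fun _ hg _ hh => hnil.commute_of_isSubnormal hsub hg hh
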